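/- Let $T>0$, $s>0$ and $\alpha>0$, let $D\subset\mathbb{R}$ be bounded and open, and put $D_T=D\times(0,T)$. Let $\mathcal{L}$ be a densely defined, self-adjoint, positive linear operator on $L^2(D)$ with compact inverse, and let $(e_j)_{j\ge1}$ be an orthonormal basis of $L^2(D)$ with $\mathcal{L}e_j=\lambda_je_j$ and $\alpha<\lambda_1\le\lambda_2\le\dots$, $\lambda_j\to+\infty$. Let $Q$ be a bounded, self-adjoint, positive semidefinite operator on $L^2(D)$ with $Qe_j=\mu_je_j$ and $\operatorname{Tr}Q=\sum_j\mu_j<+\infty$. Let $(\Omega,\mathcal{F},\mathbb{P})$ be a probability space with a normal filtration $(\mathcal{F}_t)_{t\in[0,T]}$, and let $W$ be a $Q$-Wiener process with respect to $(\mathcal F_t)$, with values in $L^2(D)$ and expansion $W(t)=\sum_j\sqrt{\mu_j}\,B_j(t)e_j$, where the $B_j$ are independent real Brownian motions with respect to $(\mathcal F_t)$. Let $y_0\in L^2(D)$ be deterministic. A solution of $dy+\mathcal{L}^sy\,dt=dW$, $y(0)=y_0$, is a jointly measurable (up to modification on a null set) $y:\Omega\times D\times[0,T]\to\mathbb{R}$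 such that, for almost every $t\in(0,T)$, almost surely, $y(\cdot,t)\in L^2(D)$ and $y(\cdot,t)=\sum_jy_j(t)e_j$ in $L^2(D)$, where, for each $j$, $y_j$ is a continuous adapted real process on $[0,T]$ solving the Itô equation $$dy_j(t)=-\lambda_j^s\,y_j(t)\,dt+\sqrt{\mu_j}\,dB_j(t),\qquad y_j(0)=\langle y_0,e_j\rangle .$$ (No decay condition linking $s$, $(\lambda_j)$ and $(\mu_j)$, and no membership of $y(\cdot,t)$ in the domain of a power of $\mathcal{L}$, is required.) Then every solution $y$ belongs to $L^2(\Omega,L^2(D_T))$ and satisfies the a priori estimate $$\|y\|_{L^2(\Omega,L^2(D_T))}\le C,$$ where $C<+\infty$ depends only on $T$, $s$, $\alpha$ and on upper bounds for $\|y_0\|_{L^2(D)}$ and $\operatorname{Tr}Q$. Moreover, $\omega\mapsto\|y(\omega)\|_{L^2(D_T)}$ is a random variable (measurable up to a null set) which is almost surely finite. -/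

import Mathlib

open MeasureTheory ProbabilityTheory Set Filter Topology
open scoped ENNReal NNReal

namespace FracSPDE

/-- The real Hilbert space `L²(D)` for `D ⊆ ℝ` with Lebesgue measure. -/
abbrev L2 (D : Set ℝ) : Type := Lp ℝ 2 ((volume : Measure ℝ).restrict D)

/-- Lebesgue measure on the space-time cylinder `D × (0,T)`; a point is `(x, t)`. -/
noncomputable def cylinderMeasure (D : Set ℝ) (T : ℝ) : Measure (ℝ × ℝ) :=
  (volume : Measure (ℝ × ℝ)).restrict (D ×ˢ Ioo (0 : ℝ) T)

section Operators

variable {H : Type*} [NormedAddCommGroup H] [InnerProductSpace ℝ H] [CompleteSpace H]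

/-- A densely defined, self-adjoint, positive (in general unbounded) linear operator
with a compact inverse. -/
structure IsDiffusionOperator (A : H →ₗ.[ℝ] H) : Prop where
  dense_domain : Dense (A.domain : Set H)
  selfAdjoint : IsSelfAdjoint A
  positive : ∀ u : A.domain, (u : H) ≠ 0 → 0 < inner ℝ (A u) (u : H)
  compact_inverse : ∃ K : H →L[ℝ] H, IsCompactOperator K ∧
    (∀ f : H, ∃ hf : K f ∈ A.domain, A ⟨K f, hf⟩ = f) ∧ ∀ u : A.domain, K (A u) = u

/-- The orthonormal basis `e` consists of eigenvectors of `A`, and `lam` lists the corresponding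
eigenvalues in nondecreasing order, with `lam j → ∞`. (Indices start at `0`.) -/
structure IsEigenbasis (A : H →ₗ.[ℝ] H) (e : HilbertBasis ℕ ℝ H) (lam : ℕ → ℝ) : Prop where
  apply_eq : ∀ j, ∃ hj : e j ∈ A.domain, A ⟨e j, hj⟩ = lam j • e j
  monotone : Monotone lam
  tendsto : Tendsto lam atTop atTop

/-- `Q` is a bounded, self-adjoint, positive semidefinite operator of finite trace, diagonal in
the basis `e` with eigenvalues `mu`. Its trace is `∑' j, mu j`. -/
structure IsCovariance (Q : H →L[ℝ] H) (e : HilbertBasis ℕ ℝ H) (mu : ℕ → ℝ) : Prop where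
  positive : Q.IsPositive
  apply_eq : ∀ j, Q (e j) = mu j • e j
  summable : Summable mu

end Operators

section Probability

variable {Ω : Type*} {mΩ : MeasurableSpace Ω}

/-- Normality of a filtration on `[0,T]`: `𝓕 0` contains all null events and `𝓕` is
right-continuous. Only the σ-algebras `𝓕 t` with `t ∈ [0,T]` matter. -/
structure IsNormalFiltration (T : ℝ) (𝓕 : Filtration ℝ mΩ) (P : Measure Ω) : Prop where
  complete : ∀ A : Set Ω, MeasurableSet A → P A = 0 → MeasurableSet[𝓕 0] A
  rightCont : ∀ t ∈ Ico (0 : ℝ) T, ∀ A : Set Ω,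
    (∀ u ∈ Ioc t T, MeasurableSet[𝓕 u] A) → MeasurableSet[𝓕 t] A

/-- `W` is a `Q`-Wiener process on `[0,T]` with values in the Hilbert space `H`, relative to the
filtration `𝓕`: it starts at `0`, has almost surely continuous paths, is adapted, and for `r ≤ t`
the increment `W t - W r` is independent of `𝓕 r` and Gaussian with law `N(0, (t - r) Q)`. -/
structure IsQWiener {H : Type*} [NormedAddCommGroup H] [InnerProductSpace ℝ H]
    (T : ℝ) (Q : H →L[ℝ] H) (𝓕 : Filtration ℝ mΩ) (P : Measure Ω) (W : ℝ → Ω → H) : Prop where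
  zero : ∀ᵐ ω ∂P, W 0 ω = 0
  continuous : ∀ᵐ ω ∂P, ContinuousOn (fun t ↦ W t ω) (Icc 0 T)
  adapted : ∀ t ∈ Icc (0 : ℝ) T, StronglyMeasurable[𝓕 t] (W t)
  indep : ∀ r ∈ Icc (0 : ℝ) T, ∀ t ∈ Icc r T,
    Indep (MeasurableSpace.comap (fun ω ↦ W t ω - W r ω) (borel H)) (𝓕 r) P
  gaussian : ∀ r ∈ Icc (0 : ℝ) T, ∀ t ∈ Icc r T, ∀ v : H,
    HasLaw (fun ω ↦ inner ℝ (W t ω - W r ω) v)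
      (gaussianReal 0 ((t - r) * inner ℝ (Q v) v).toNNReal) P

/-- A standard real Brownian motion on `[0,T]` relative to `𝓕`. -/
def IsBrownian (T : ℝ) (𝓕 : Filtration ℝ mΩ) (P : Measure Ω) (B : ℝ → Ω → ℝ) : Prop :=
  IsQWiener T (ContinuousLinearMap.id ℝ ℝ) 𝓕 P B

/-- `B` is a sequence of independent Brownian motions on `[0,T]` through which the process `W` is
expanded as `W(t) = ∑ⱼ √(mu j) B j (t) e j`, almost surely for all `t ∈ [0,T]`. -/
structure IsWienerExpansion {H : Type*} [NormedAddCommGroup H] [InnerProductSpace ℝ H]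
    (T : ℝ) (e : HilbertBasis ℕ ℝ H) (mu : ℕ → ℝ) (𝓕 : Filtration ℝ mΩ) (P : Measure Ω)
    (W : ℝ → Ω → H) (B : ℕ → ℝ → Ω → ℝ) : Prop where
  brownian : ∀ j, IsBrownian T 𝓕 P (B j)
  indep : iIndepFun (fun j ω ↦ fun t : Icc (0 : ℝ) T ↦ B j t ω) P
  hasSum : ∀ᵐ ω ∂P, ∀ t ∈ Icc (0 : ℝ) T,
    HasSum (fun j ↦ (√(mu j) * B j t ω) • e j) (W t ω)

/-- `Z` is a (strong) solution on `[0,T]` of the real Itô equation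
`dZ = -θ Z dt + σ dB`, `Z(0) = z₀`, with constants `θ, σ`: a continuous adapted process that
satisfies the integrated equation. Since `σ` is constant, the Itô integral `∫₀ᵗ σ dB` is
`σ (B t - B 0)`. -/
structure IsItoSolution (T θ σ z₀ : ℝ) (𝓕 : Filtration ℝ mΩ) (P : Measure Ω)
    (B Z : ℝ → Ω → ℝ) : Prop where
  adapted : ∀ t ∈ Icc (0 : ℝ) T, StronglyMeasurable[𝓕 t] (Z t)
  continuous : ∀ᵐ ω ∂P, ContinuousOn (fun t ↦ Z t ω) (Icc 0 T)
  eqn : ∀ᵐ ω ∂P, ∀ t ∈ Icc (0 : ℝ) T,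
    Z t ω = z₀ - θ * (∫ τ in (0 : ℝ)..t, Z τ ω) + σ * (B t ω - B 0 ω)

/-- `y : Ω × D × [0,T] → ℝ`, written `y ω (x, t)`, is a solution of
`dy + 𝓛ˢ y dt = dW`, `y(0) = y₀`, where `𝓛ˢ` has the eigenvalues `(lam j) ^ s` on the basis `e`:
`y` is jointly measurable and `y(t) = ∑ⱼ Y j (t) e j` in `L²(D)` for almost every `t`, almost
surely, where `Y j` solves `dY j = -(lam j)^s Y j dt + √(mu j) dB j`, `Y j (0) = ⟨y₀, e j⟩`.
Nothing is required about the membership of `y(t)` in the domain of a power of `𝓛`. -/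
structure IsSolution (D : Set ℝ) (T s : ℝ) (e : HilbertBasis ℕ ℝ (L2 D)) (lam mu : ℕ → ℝ)
    (y₀ : L2 D) (𝓕 : Filtration ℝ mΩ) (P : Measure Ω) (B : ℕ → ℝ → Ω → ℝ)
    (y : Ω → ℝ × ℝ → ℝ) : Prop where
  measurable : AEStronglyMeasurable (Function.uncurry y) (P.prod (cylinderMeasure D T))
  expansion : ∃ Y : ℕ → ℝ → Ω → ℝ,
    (∀ j, IsItoSolution T (lam j ^ s) √(mu j) (inner ℝ y₀ (e j)) 𝓕 P (B j) (Y j)) ∧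
    ∀ᵐ t ∂((volume : Measure ℝ).restrict (Ioo 0 T)), ∀ᵐ ω ∂P,
      ∃ h : MemLp (fun x ↦ y ω (x, t)) 2 ((volume : Measure ℝ).restrict D),
        HasSum (fun j ↦ Y j t ω • e j) (h.toLp (fun x ↦ y ω (x, t)))

end Probability

end FracSPDE

namespace FracSPDE

/-! The noise is additive, so each mode can be treated path by path, without Itô's formula. With `b
= σ (B - B 0)`, the difference `v = z - b` is differentiable with `v' = -θ z`, and `(v²)' = -2θ z (z
- b) ≤ -θ (z² - b²)`. Integrating gives `∫ z² ≤ z₀² / θ + ∫ b²` (`integral_sq_le_of_integral_eq`).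
The noise term carries no factor `θ`, which is why no decay condition on the eigenvalues is needed.
Taking expectations and using `E (B t - B 0)² = t ≤ T`, mode `j` contributes at most `⟨y₀, e j⟩² / α
^ s + mu j * T ^ 2`. Parseval and Tonelli sum this to `‖y₀‖² / α ^ s + Tr Q * T ^ 2`
(`IsSolution.lintegral_enorm_sq_le`). It remains to read `y` as a strongly measurable `L²`-valued
map (`exists_memLp_Lp_of_lintegral_lt_top`). -/

/-! ### Pathwise energy estimate -/

/-- Energy estimate for the integrated equation `z t = z₀ - θ ∫₀ᵗ z + b t`. -/
theorem integral_sq_le_of_integral_eq {T θ z₀ : ℝ} (hT : 0 ≤ T) (hθ : 0 < θ) {z b : ℝ → ℝ}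
    (hz : ContinuousOn z (Icc 0 T)) (hb : ContinuousOn b (Icc 0 T))
    (h : ∀ t ∈ Icc (0 : ℝ) T, z t = z₀ - θ * (∫ τ in (0 : ℝ)..t, z τ) + b t) (hb0 : b 0 = 0) :
    ∫ t in (0 : ℝ)..T, z t ^ 2 ≤ z₀ ^ 2 / θ + ∫ t in (0 : ℝ)..T, b t ^ 2 := by
  have hint : ∀ f : ℝ → ℝ, ContinuousOn f (Icc 0 T) → IntervalIntegrable f volume 0 T :=
    fun f hf ↦ (by rwa [uIcc_of_le hT] : ContinuousOn f (uIcc 0 T)).intervalIntegrable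
  have hz2 : IntervalIntegrable (fun t ↦ z t ^ 2) volume 0 T := hint _ (hz.pow 2)
  have hb2 : IntervalIntegrable (fun t ↦ b t ^ 2) volume 0 T := hint _ (hb.pow 2)
  have hv : ContinuousOn (fun t ↦ z t - b t) (Icc 0 T) := hz.sub hb
  have hderiv : ∀ t ∈ Ioo (0 : ℝ) T, HasDerivAt (fun t ↦ z t - b t) (-(θ * z t)) t := by
    intro t ht
    have hnhds : Icc (0 : ℝ) T ∈ 𝓝 t := Icc_mem_nhds ht.1 ht.2
    have hzt : IntervalIntegrable z volume 0 t :=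
      (hint z hz).mono_set (by
        rw [uIcc_of_le hT, uIcc_of_le ht.1.le]
        exact Icc_subset_Icc_right ht.2.le)
    have hmeas : StronglyMeasurableAtFilter z (𝓝 t) volume :=
      ⟨Icc 0 T, hnhds, hz.aestronglyMeasurable measurableSet_Icc⟩
    have hd := intervalIntegral.integral_hasDerivAt_right hzt hmeas (hz.continuousAt hnhds)
    refine ((hd.const_mul θ).const_sub z₀).congr_of_eventuallyEq ?_
    filter_upwards [hnhds] with u hu
    rw [h u hu]
    ring
  have hftc := intervalIntegral.integral_eq_sub_of_hasDerivAt_of_le hT (hv.pow 2)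
    (fun t ht ↦ (hderiv t ht).pow 2)
    (hint _ (by fun_prop))
  have h0 : z 0 = z₀ := by
    have := h 0 ⟨le_rfl, hT⟩
    simpa [hb0] using this
  -- Pointwise, `2 z (z - b) - (z² - b²) = (z - b)² ≥ 0`.
  have hle : ∫ t in (0 : ℝ)..T, θ * (z t ^ 2 - b t ^ 2) ≤
      ∫ t in (0 : ℝ)..T, -(((2 : ℕ) : ℝ) * (z t - b t) ^ (2 - 1) * -(θ * z t)) := by
    refine intervalIntegral.integral_mono_on hT (hint _ (by fun_prop)) (hint _ (by fun_prop)) ?_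
    intro t _
    have := mul_nonneg hθ.le (sq_nonneg (z t - b t))
    norm_num
    linarith
  rw [intervalIntegral.integral_neg, hftc, intervalIntegral.integral_const_mul,
    intervalIntegral.integral_sub hz2 hb2] at hle
  simp only [Pi.pow_apply, h0, hb0, sub_zero] at hle
  have h3 : θ * (∫ t in (0 : ℝ)..T, z t ^ 2) ≤ z₀ ^ 2 + θ * ∫ t in (0 : ℝ)..T, b t ^ 2 := by
    nlinarith [sq_nonneg (z T - b T)]
  rw [div_add' _ _ _ hθ.ne', le_div_iff₀ hθ]
  linarith

theorem setLIntegral_enorm_sq_eq_ofReal {T : ℝ} (hT : 0 ≤ T) {f : ℝ → ℝ}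
    (hf : ContinuousOn f (Icc 0 T)) :
    ∫⁻ t in Ioo 0 T, ‖f t‖ₑ ^ 2 = ENNReal.ofReal (∫ t in (0 : ℝ)..T, f t ^ 2) := by
  have hi : IntegrableOn (fun t ↦ f t ^ 2) (Ioo 0 T) :=
    (hf.pow 2).integrableOn_Icc.mono_set Ioo_subset_Icc_self
  rw [intervalIntegral.integral_of_le hT, integral_Ioc_eq_integral_Ioo,
    ofReal_integral_eq_lintegral_ofReal hi (Eventually.of_forall fun t ↦ sq_nonneg (f t))]
  refine lintegral_congr fun t ↦ ?_
  rw [Real.enorm_eq_ofReal_abs, ← ENNReal.ofReal_pow (abs_nonneg _), sq_abs]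

/-! ### Measurability and second moments of one mode -/

/-- A process with continuous paths on `[0,T]` is jointly measurable up to null sets. -/
theorem aemeasurable_uncurry_of_continuousOn {Ω : Type*} {mΩ : MeasurableSpace Ω} {P : Measure Ω}
    [SFinite P] {T : ℝ} (hT : 0 ≤ T) {X : ℝ → Ω → ℝ} (hX : ∀ t ∈ Icc (0 : ℝ) T, Measurable (X t))
    (hc : ∀ᵐ ω ∂P, ContinuousOn (fun t ↦ X t ω) (Icc 0 T)) :
    AEMeasurable (fun p : ℝ × Ω ↦ X p.1 p.2)
      (((volume : Measure ℝ).restrict (Ioo 0 T)).prod P) := by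
  classical
  obtain ⟨N, hN, hNm, hN0⟩ := exists_measurable_superset_of_null (ae_iff.mp hc)
  -- Clamping time to `[0,T]` and setting the process to zero on the null set `N` makes every path
  -- continuous on all of `ℝ`.
  let Z : ℝ → Ω → ℝ := fun t ↦ Nᶜ.indicator (X (projIcc 0 T hT t))
  have hZ : Measurable (Function.uncurry Z) := by
    refine measurable_uncurry_of_continuous_of_measurable (fun ω ↦ ?_)
      fun t ↦ (hX _ (projIcc 0 T hT t).2).indicator hNm.compl
    by_cases hω : ω ∈ N
    · simp only [Z, indicator_of_notMem (show ω ∉ Nᶜ from fun h ↦ h hω)]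
      exact continuous_const
    · simp only [Z, indicator_of_mem (show ω ∈ Nᶜ from hω)]
      have hcont : ContinuousOn (fun t ↦ X t ω) (Icc 0 T) := by
        by_contra h
        exact hω (hN h)
      exact hcont.comp_continuous (continuous_subtype_val.comp continuous_projIcc)
        fun t ↦ (projIcc 0 T hT t).2
  refine ⟨_, hZ, ?_⟩
  have h1 : ∀ᵐ p ∂((volume : Measure ℝ).restrict (Ioo 0 T)).prod P, p.1 ∈ Ioo 0 T :=
    Measure.quasiMeasurePreserving_fst.ae (ae_restrict_mem measurableSet_Ioo)
  have h2 : ∀ᵐ p ∂((volume : Measure ℝ).restrict (Ioo 0 T)).prod P, p.2 ∉ N :=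
    Measure.quasiMeasurePreserving_snd.ae (measure_eq_zero_iff_ae_notMem.mp hN0)
  filter_upwards [h1, h2] with p hp1 hp2
  simp only [Function.uncurry, Z, indicator_of_mem (show p.2 ∈ Nᶜ from hp2),
    projIcc_of_mem hT (Ioo_subset_Icc_self hp1)]

theorem lintegral_enorm_sq_of_hasLaw_gaussianReal {Ω : Type*} {mΩ : MeasurableSpace Ω}
    {P : Measure Ω} {X : Ω → ℝ} {v : ℝ≥0} (h : HasLaw X (gaussianReal 0 v) P) :
    ∫⁻ ω, ‖X ω‖ₑ ^ 2 ∂P = v := by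
  have h1 := h.lintegral_comp (f := fun x ↦ ‖x‖ₑ ^ 2) (by fun_prop)
  have h2 := (memLp_id_gaussianReal (μ := 0) (v := v) 2).ofReal_variance_eq
  rw [variance_id_gaussianReal, evariance] at h2
  simp only [id, integral_id_gaussianReal, sub_zero, ENNReal.ofReal_coe_nnreal] at h2
  rw [h1, ← h2]

theorem lintegral_enorm_sq_brownian_le {Ω : Type*} {mΩ : MeasurableSpace Ω} {P : Measure Ω}
    [SFinite P] {T : ℝ} (hT : 0 ≤ T) {𝓕 : Filtration ℝ mΩ} {B : ℝ → Ω → ℝ}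
    (hB : IsBrownian T 𝓕 P B) :
    ∫⁻ p, ‖B p.1 p.2 - B 0 p.2‖ₑ ^ 2 ∂((volume : Measure ℝ).restrict (Ioo 0 T)).prod P ≤
      ENNReal.ofReal (T ^ 2) := by
  have hmeas : ∀ t ∈ Icc (0 : ℝ) T, Measurable (B t) := fun t ht ↦
    ((hB.adapted t ht).mono (𝓕.le t)).measurable
  have hm : AEMeasurable (fun p : ℝ × Ω ↦ B p.1 p.2 - B 0 p.2)
      (((volume : Measure ℝ).restrict (Ioo 0 T)).prod P) :=
    (aemeasurable_uncurry_of_continuousOn hT hmeas hB.continuous).sub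
      ((hmeas 0 ⟨le_rfl, hT⟩).comp measurable_snd).aemeasurable
  rw [lintegral_prod _ (hm.enorm.pow_const 2)]
  calc ∫⁻ t in Ioo 0 T, ∫⁻ ω, ‖B t ω - B 0 ω‖ₑ ^ 2 ∂P
      ≤ ∫⁻ _ in Ioo 0 T, ENNReal.ofReal T := by
        refine setLIntegral_mono measurable_const fun t ht ↦ ?_
        have hlaw := hB.gaussian 0 ⟨le_rfl, hT⟩ t ⟨ht.1.le, ht.2.le⟩ 1
        have := lintegral_enorm_sq_of_hasLaw_gaussianReal hlaw
        simp only [ContinuousLinearMap.id_apply, sub_zero] at this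
        simp at this
        rw [this]
        exact ENNReal.ofReal_le_ofReal ht.2.le
    _ = ENNReal.ofReal (T ^ 2) := by
        rw [setLIntegral_const, Real.volume_Ioo, sub_zero, ← ENNReal.ofReal_mul hT, sq]

theorem IsItoSolution.aemeasurable {Ω : Type*} {mΩ : MeasurableSpace Ω} {P : Measure Ω}
    [SFinite P] {T θ σ z₀ : ℝ} (hT : 0 ≤ T) {𝓕 : Filtration ℝ mΩ} {B Z : ℝ → Ω → ℝ}
    (hZ : IsItoSolution T θ σ z₀ 𝓕 P B Z) :
    AEMeasurable (fun p : ℝ × Ω ↦ Z p.1 p.2)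
      (((volume : Measure ℝ).restrict (Ioo 0 T)).prod P) :=
  aemeasurable_uncurry_of_continuousOn hT
    (fun t ht ↦ ((hZ.adapted t ht).mono (𝓕.le t)).measurable) hZ.continuous

theorem IsItoSolution.lintegral_enorm_sq_le {Ω : Type*} {mΩ : MeasurableSpace Ω} {P : Measure Ω}
    [IsProbabilityMeasure P] {T θ σ z₀ : ℝ} (hT : 0 ≤ T) (hθ : 0 < θ) {𝓕 : Filtration ℝ mΩ}
    {B Z : ℝ → Ω → ℝ} (hB : IsBrownian T 𝓕 P B) (hZ : IsItoSolution T θ σ z₀ 𝓕 P B Z) :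
    ∫⁻ p, ‖Z p.1 p.2‖ₑ ^ 2 ∂((volume : Measure ℝ).restrict (Ioo 0 T)).prod P ≤
      ENNReal.ofReal (z₀ ^ 2 / θ + σ ^ 2 * T ^ 2) := by
  have hmeas : ∀ t ∈ Icc (0 : ℝ) T, Measurable (B t) := fun t ht ↦
    ((hB.adapted t ht).mono (𝓕.le t)).measurable
  have hm : AEMeasurable (fun p : ℝ × Ω ↦ ‖B p.1 p.2 - B 0 p.2‖ₑ ^ 2)
      (((volume : Measure ℝ).restrict (Ioo 0 T)).prod P) :=
    ((aemeasurable_uncurry_of_continuousOn hT hmeas hB.continuous).sub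
      ((hmeas 0 ⟨le_rfl, hT⟩).comp measurable_snd).aemeasurable).enorm.pow_const 2
  -- The energy estimate is pathwise, so time must be the inner integral; the Brownian variance
  -- bound later uses the opposite order.
  rw [lintegral_prod_symm _ ((hZ.aemeasurable hT).enorm.pow_const 2)]
  calc ∫⁻ ω, (∫⁻ t in Ioo 0 T, ‖Z t ω‖ₑ ^ 2) ∂P
      ≤ ∫⁻ ω, (ENNReal.ofReal (z₀ ^ 2 / θ) +
          ENNReal.ofReal (σ ^ 2) * ∫⁻ t in Ioo 0 T, ‖B t ω - B 0 ω‖ₑ ^ 2) ∂P := by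
        refine lintegral_mono_ae ?_
        filter_upwards [hB.continuous, hZ.continuous, hZ.eqn] with ω h1 h2 h3
        have h4 : ContinuousOn (fun t ↦ B t ω - B 0 ω) (Icc 0 T) := h1.sub continuousOn_const
        have h5 := integral_sq_le_of_integral_eq hT hθ h2
          (continuousOn_const (c := σ) |>.mul h4) h3 (by simp)
        have h6 : 0 ≤ ∫ t in (0 : ℝ)..T, (B t ω - B 0 ω) ^ 2 :=
          intervalIntegral.integral_nonneg hT fun t _ ↦ sq_nonneg _
        rw [setLIntegral_enorm_sq_eq_ofReal hT h2, setLIntegral_enorm_sq_eq_ofReal hT h4,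
          ← ENNReal.ofReal_mul (sq_nonneg σ), ← ENNReal.ofReal_add (by positivity) (by positivity)]
        refine ENNReal.ofReal_le_ofReal (h5.trans_eq ?_)
        rw [← intervalIntegral.integral_const_mul]
        simp only [Pi.mul_apply, mul_pow]
    _ = ENNReal.ofReal (z₀ ^ 2 / θ) + ENNReal.ofReal (σ ^ 2) *
          ∫⁻ ω, (∫⁻ t in Ioo 0 T, ‖B t ω - B 0 ω‖ₑ ^ 2) ∂P := by
        rw [lintegral_add_left measurable_const, lintegral_const, measure_univ, mul_one,
          lintegral_const_mul' _ _ ENNReal.ofReal_ne_top]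
    _ ≤ ENNReal.ofReal (z₀ ^ 2 / θ) + ENNReal.ofReal (σ ^ 2) * ENNReal.ofReal (T ^ 2) := by
        gcongr
        rw [← lintegral_prod_symm _ hm]
        exact lintegral_enorm_sq_brownian_le hT hB
    _ = ENNReal.ofReal (z₀ ^ 2 / θ + σ ^ 2 * T ^ 2) := by
        rw [← ENNReal.ofReal_mul (sq_nonneg σ), ← ENNReal.ofReal_add (by positivity) (by positivity)]

/-! ### Parseval and summation over the modes -/

theorem enorm_sq_eq_tsum_of_hasSum {H : Type*} [NormedAddCommGroup H] [InnerProductSpace ℝ H]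
    (e : HilbertBasis ℕ ℝ H) {c : ℕ → ℝ} {f : H} (h : HasSum (fun j ↦ c j • e j) f) :
    ‖f‖ₑ ^ 2 = ∑' j, ‖c j‖ₑ ^ 2 := by
  have hc : ∀ j, inner ℝ f (e j) = c j := by
    intro j
    have h1 := h.mapL (innerSL ℝ (e j))
    have h2 := hasSum_single (f := fun i ↦ innerSL ℝ (e j) (c i • e i)) j fun i hi ↦ by
      simp [orthonormal_iff_ite.mp e.orthonormal, hi.symm]
    rw [real_inner_comm]
    have := h1.unique h2
    simpa [inner_smul_right, e.orthonormal.1 j] using this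
  have h3 := e.hasSum_inner_mul_inner f f
  simp_rw [real_inner_comm f, hc] at h3
  have h4 : HasSum (fun j ↦ c j ^ 2) (‖f‖ ^ 2) := by
    simpa [sq, real_inner_self_eq_norm_sq] using h3
  have h5 : ∀ r : ℝ, ‖r‖ₑ ^ 2 = ENNReal.ofReal (r ^ 2) := fun r ↦ by
    rw [Real.enorm_eq_ofReal_abs, ← ENNReal.ofReal_pow (abs_nonneg r), sq_abs]
  simp_rw [h5]
  rw [← ENNReal.ofReal_tsum_of_nonneg (fun j ↦ sq_nonneg _) h4.summable, h4.tsum_eq,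
    ← ofReal_norm, ENNReal.ofReal_pow (norm_nonneg f)]

theorem eLpNorm_two_sq {α E : Type*} {mα : MeasurableSpace α} [NormedAddCommGroup E]
    (f : α → E) (μ : Measure α) : eLpNorm f 2 μ ^ 2 = ∫⁻ x, ‖f x‖ₑ ^ 2 ∂μ := by
  have := eLpNorm_nnreal_pow_eq_lintegral (f := f) (μ := μ) (p := 2) two_ne_zero
  simpa using this

theorem cylinderMeasure_eq_prod (D : Set ℝ) (T : ℝ) :
    cylinderMeasure D T =
      ((volume : Measure ℝ).restrict D).prod ((volume : Measure ℝ).restrict (Ioo 0 T)) := by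
  rw [cylinderMeasure, Measure.volume_eq_prod, Measure.prod_restrict]

/-- Moving the last of three coordinates to the front preserves product measures. -/
theorem measurePreserving_rotate {α β γ : Type*} [MeasurableSpace α] [MeasurableSpace β]
    [MeasurableSpace γ] (μ : Measure α) (ν : Measure β) (ρ : Measure γ) [SFinite μ] [SFinite ν]
    [SFinite ρ] :
    MeasurePreserving (fun q : γ × α × β ↦ (q.2.1, (q.2.2, q.1)))
      (ρ.prod (μ.prod ν)) (μ.prod (ν.prod ρ)) :=
  (measurePreserving_prodAssoc μ ν ρ).comp Measure.measurePreserving_swap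

theorem IsSolution.lintegral_enorm_sq_le {Ω : Type*} {mΩ : MeasurableSpace Ω} {P : Measure Ω}
    [IsProbabilityMeasure P] {D : Set ℝ} {T s α R M : ℝ} (hT : 0 < T) (hs : 0 < s) (hα : 0 < α)
    {e : HilbertBasis ℕ ℝ (L2 D)} {lam mu : ℕ → ℝ} (hlam : ∀ j, α < lam j)
    (hmu : ∀ j, 0 ≤ mu j) (hsum : Summable mu) (hM : ∑' j, mu j ≤ M) {𝓕 : Filtration ℝ mΩ}
    {B : ℕ → ℝ → Ω → ℝ} (hB : ∀ j, IsBrownian T 𝓕 P (B j)) {y₀ : L2 D} (hy₀ : ‖y₀‖ ≤ R)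
    {y : Ω → ℝ × ℝ → ℝ} (hy : IsSolution D T s e lam mu y₀ 𝓕 P B y) :
    ∫⁻ p, ‖y p.1 p.2‖ₑ ^ 2 ∂P.prod (cylinderMeasure D T) ≤
      ENNReal.ofReal (R ^ 2 / α ^ s + M * T ^ 2) := by
  obtain ⟨hm, Y, hY, hexp⟩ := hy
  rw [cylinderMeasure_eq_prod] at hm ⊢
  have hrot := measurePreserving_rotate P ((volume : Measure ℝ).restrict D)
    ((volume : Measure ℝ).restrict (Ioo 0 T))
  have hF : AEMeasurable (fun p : Ω × ℝ × ℝ ↦ ‖y p.1 p.2‖ₑ ^ 2)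
      (P.prod (((volume : Measure ℝ).restrict D).prod
        ((volume : Measure ℝ).restrict (Ioo 0 T)))) := hm.enorm.pow_const 2
  have hG := hF.comp_quasiMeasurePreserving hrot.quasiMeasurePreserving
  -- The expansion holds for almost every `t`, and then almost surely, so `t` has to become the
  -- outermost variable.
  rw [← hrot.map_eq, lintegral_map' (by rwa [hrot.map_eq]) hrot.measurable.aemeasurable]
  refine (lintegral_prod _ hG).trans_le ?_
  have hαs : 0 < α ^ s := Real.rpow_pos_of_pos hα s
  have hY2 : ∀ j, AEMeasurable (fun p : ℝ × Ω ↦ ‖Y j p.1 p.2‖ₑ ^ 2)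
      (((volume : Measure ℝ).restrict (Ioo 0 T)).prod P) := fun j ↦
    ((hY j).aemeasurable hT.le).enorm.pow_const 2
  have hpars : HasSum (fun j ↦ inner ℝ y₀ (e j) ^ 2) (‖y₀‖ ^ 2) := by
    have := e.hasSum_inner_mul_inner y₀ y₀
    simp_rw [real_inner_comm y₀] at this
    simpa [sq, real_inner_self_eq_norm_sq] using this
  calc ∫⁻ t in Ioo 0 T, ∫⁻ q, ‖y q.1 (q.2, t)‖ₑ ^ 2 ∂P.prod ((volume : Measure ℝ).restrict D)
      = ∫⁻ t in Ioo 0 T, ∫⁻ ω, ∑' j, ‖Y j t ω‖ₑ ^ 2 ∂P := by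
        refine lintegral_congr_ae ?_
        have hsec : ∀ᵐ t ∂(volume : Measure ℝ).restrict (Ioo 0 T),
            AEMeasurable (fun q : Ω × ℝ ↦ ‖y q.1 (q.2, t)‖ₑ ^ 2)
              (P.prod ((volume : Measure ℝ).restrict D)) := by
          filter_upwards [hG.aestronglyMeasurable.prodMk_left] with t ht
          exact ht.aemeasurable
        filter_upwards [hexp, hsec] with t ht hmt
        rw [lintegral_prod _ hmt]
        refine lintegral_congr_ae ?_
        filter_upwards [ht] with ω ⟨h, hω⟩
        rw [← enorm_sq_eq_tsum_of_hasSum e hω, Lp.enorm_toLp, eLpNorm_two_sq]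
    _ = ∑' j, ∫⁻ p, ‖Y j p.1 p.2‖ₑ ^ 2 ∂((volume : Measure ℝ).restrict (Ioo 0 T)).prod P := by
        rw [← lintegral_tsum hY2, lintegral_prod _ (AEMeasurable.tsum hY2)]
    _ ≤ ∑' j, ENNReal.ofReal (inner ℝ y₀ (e j) ^ 2 / α ^ s + mu j * T ^ 2) := by
        refine ENNReal.tsum_le_tsum fun j ↦ ?_
        -- The spectral gap makes the bound on the initial-value term uniform in `j`.
        have hθ : α ^ s ≤ lam j ^ s := Real.rpow_le_rpow hα.le (hlam j).le hs.le
        refine ((hY j).lintegral_enorm_sq_le hT.le (hαs.trans_le hθ) (hB j)).trans ?_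
        rw [Real.sq_sqrt (hmu j)]
        gcongr
    _ = ENNReal.ofReal (‖y₀‖ ^ 2 / α ^ s + (∑' j, mu j) * T ^ 2) := by
        have h1 := (hpars.div_const (α ^ s)).add (hsum.hasSum.mul_right (T ^ 2))
        rw [← h1.tsum_eq, ENNReal.ofReal_tsum_of_nonneg _ h1.summable]
        intro j
        have := hmu j
        positivity
    _ ≤ ENNReal.ofReal (R ^ 2 / α ^ s + M * T ^ 2) := by gcongr

/-! ### From functions on a product to `L²`-valued random variables -/

/-- By the Lindelöf property an open set is a countable union of balls, whose preimages are sublevel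
sets of distances. In `L²` these distances are parameter integrals, measurable by Tonelli. -/
theorem measurable_of_measurable_dist {α X : Type*} [MeasurableSpace α] [PseudoMetricSpace X]
    [SecondCountableTopology X] [MeasurableSpace X] [BorelSpace X] {f : α → X}
    (h : ∀ c, Measurable fun a ↦ dist (f a) c) : Measurable f := by
  refine measurable_of_isOpen fun U hU ↦ ?_
  choose! r hr hrU using Metric.isOpen_iff.mp hU
  obtain ⟨S, hS, hSU⟩ := TopologicalSpace.isOpen_iUnion_countable
    (fun x : U ↦ Metric.ball (x : X) (r x)) fun _ ↦ Metric.isOpen_ball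
  have hU' : U = ⋃ x ∈ S, Metric.ball (x : X) (r x) := by
    rw [hSU]
    refine Subset.antisymm (fun x hx ↦ mem_iUnion.2 ⟨⟨x, hx⟩, Metric.mem_ball_self (hr x hx)⟩) ?_
    exact iUnion_subset fun x ↦ hrU x x.2
  rw [hU', preimage_iUnion₂]
  exact MeasurableSet.biUnion hS fun x _ ↦ h x measurableSet_Iio

/-- A square-integrable function on a product defines a square-integrable `L²`-valued function. -/
theorem exists_memLp_Lp_of_lintegral_lt_top {Ω X : Type*} {mΩ : MeasurableSpace Ω}
    [MeasurableSpace X] {P : Measure Ω} [SFinite P] {ν : Measure X} [SFinite ν]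
    [IsSeparable ν] {y : Ω → X → ℝ}
    (hm : AEStronglyMeasurable (Function.uncurry y) (P.prod ν))
    (hy : ∫⁻ p, ‖y p.1 p.2‖ₑ ^ 2 ∂P.prod ν < ∞) :
    ∃ Y : Ω → Lp ℝ 2 ν, AEStronglyMeasurable Y P ∧ (∀ᵐ ω ∂P, Y ω =ᵐ[ν] y ω) ∧
      eLpNorm Y 2 P ^ 2 = ∫⁻ p, ‖y p.1 p.2‖ₑ ^ 2 ∂P.prod ν := by
  classical
  obtain ⟨g, hg, hyg⟩ := hm
  have hgω : ∀ ω, StronglyMeasurable fun x ↦ g (ω, x) := fun ω ↦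
    hg.comp_measurable measurable_prodMk_left
  have hyg' : ∀ᵐ ω ∂P, y ω =ᵐ[ν] fun x ↦ g (ω, x) := Measure.ae_ae_of_ae_prod hyg
  have heLp : ∀ c : X → ℝ, Measurable c → Measurable fun ω ↦
      eLpNorm ((fun x ↦ g (ω, x)) - c) 2 ν := by
    intro c hc
    have h1 : Measurable fun ω ↦ ∫⁻ x, ‖g (ω, x) - c x‖ₑ ^ 2 ∂ν :=
      Measurable.lintegral_prod_right'
        (f := fun p : Ω × X ↦ ‖g p - c p.2‖ₑ ^ 2)
        ((hg.measurable.sub (hc.comp measurable_snd)).enorm.pow_const 2)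
    have h2 : ∀ ω, eLpNorm ((fun x ↦ g (ω, x)) - c) 2 ν =
        (∫⁻ x, ‖g (ω, x) - c x‖ₑ ^ 2 ∂ν) ^ (1 / 2 : ℝ) := fun ω ↦ by
      have h3 : eLpNorm ((fun x ↦ g (ω, x)) - c) 2 ν ^ 2 = ∫⁻ x, ‖g (ω, x) - c x‖ₑ ^ 2 ∂ν :=
        eLpNorm_two_sq _ _
      rw [← h3, ← ENNReal.rpow_natCast, ← ENNReal.rpow_mul]
      norm_num
    simp_rw [h2]
    exact h1.pow_const _
  have hg0 : Measurable fun ω ↦ eLpNorm (fun x ↦ g (ω, x)) 2 ν := by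
    simpa using heLp 0 measurable_zero
  let S : Set Ω := {ω | eLpNorm (fun x ↦ g (ω, x)) 2 ν < ∞}
  have hS : MeasurableSet S := measurableSet_lt hg0 measurable_const
  -- The value `0` off `S` is harmless: `S` has full measure because the double integral is finite.
  let Y : Ω → Lp ℝ 2 ν := fun ω ↦
    if h : ω ∈ S then MemLp.toLp (fun x ↦ g (ω, x)) ⟨(hgω ω).aestronglyMeasurable, h⟩ else 0
  have hYS : ∀ ω ∈ S, Y ω =ᵐ[ν] fun x ↦ g (ω, x) := fun ω hω ↦ by
    simp only [Y, dif_pos hω]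
    exact MemLp.coeFn_toLp _
  have hYm : StronglyMeasurable Y := by
    let : MeasurableSpace (Lp ℝ 2 ν) := borel _
    have : BorelSpace (Lp ℝ 2 ν) := ⟨rfl⟩
    have : Fact ((2 : ℝ≥0∞) ≠ ∞) := ⟨ENNReal.ofNat_ne_top⟩
    refine (measurable_of_measurable_dist fun c ↦ ?_).stronglyMeasurable
    have h1 : (fun ω ↦ dist (Y ω) c) = fun ω ↦
        if ω ∈ S then (eLpNorm ((fun x ↦ g (ω, x)) - (c : X → ℝ)) 2 ν).toReal else dist 0 c := by
      funext ω
      split_ifs with hω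
      · rw [Lp.dist_def]
        congr 1
        exact eLpNorm_congr_ae ((hYS ω hω).sub EventuallyEq.rfl)
      · simp only [Y, dif_neg hω]
    rw [h1]
    exact Measurable.ite hS (heLp c (Lp.stronglyMeasurable c).measurable).ennreal_toReal
      measurable_const
  have hae : ∫⁻ p, ‖y p.1 p.2‖ₑ ^ 2 ∂P.prod ν = ∫⁻ p, ‖g p‖ₑ ^ 2 ∂P.prod ν := by
    refine lintegral_congr_ae ?_
    filter_upwards [hyg] with p hp
    rw [← hp, Function.uncurry]
  have hprod : ∫⁻ p, ‖g p‖ₑ ^ 2 ∂P.prod ν = ∫⁻ ω, eLpNorm (fun x ↦ g (ω, x)) 2 ν ^ 2 ∂P := by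
    rw [lintegral_prod _ (hg.measurable.enorm.pow_const 2).aemeasurable]
    simp_rw [eLpNorm_two_sq]
  have hSae : ∀ᵐ ω ∂P, ω ∈ S := by
    rw [hae, hprod] at hy
    filter_upwards [ae_lt_top (hg0.pow_const 2) hy.ne] with ω hω
    exact (ENNReal.pow_lt_top_iff.mp hω).resolve_right two_ne_zero
  refine ⟨Y, hYm.aestronglyMeasurable, ?_, ?_⟩
  · filter_upwards [hSae, hyg'] with ω h1 h2
    exact (hYS ω h1).trans h2.symm
  · rw [eLpNorm_two_sq, hae, hprod]
    refine lintegral_congr_ae ?_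
    filter_upwards [hSae] with ω hω
    rw [Lp.enorm_def, eLpNorm_congr_ae (hYS ω hω)]

end FracSPDE

theorem mainTheorem8 (T s α R M : ℝ) (hT : 0 < T) (hs : 0 < s) (hα : 0 < α) :
    ∃ C : ℝ, 0 ≤ C ∧
      ∀ (D : Set ℝ), IsOpen D → Bornology.IsBounded D →
      ∀ (A : FracSPDE.L2 D →ₗ.[ℝ] FracSPDE.L2 D), FracSPDE.IsDiffusionOperator A →
      ∀ (e : HilbertBasis ℕ ℝ (FracSPDE.L2 D)) (lam : ℕ → ℝ),
        FracSPDE.IsEigenbasis A e lam → (∀ j, α < lam j) →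
      ∀ (Q : FracSPDE.L2 D →L[ℝ] FracSPDE.L2 D) (mu : ℕ → ℝ),
        FracSPDE.IsCovariance Q e mu → ∑' j, mu j ≤ M →
      ∀ (Ω : Type*) (mΩ : MeasurableSpace Ω) (P : Measure Ω), IsProbabilityMeasure P →
      ∀ (𝓕 : Filtration ℝ mΩ), FracSPDE.IsNormalFiltration T 𝓕 P →
      ∀ (W : ℝ → Ω → FracSPDE.L2 D) (B : ℕ → ℝ → Ω → ℝ),
        FracSPDE.IsQWiener T Q 𝓕 P W → FracSPDE.IsWienerExpansion T e mu 𝓕 P W B →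
      ∀ (y₀ : FracSPDE.L2 D), ‖y₀‖ ≤ R →
      ∀ (y : Ω → ℝ × ℝ → ℝ), FracSPDE.IsSolution D T s e lam mu y₀ 𝓕 P B y →
        (∃ Y : Ω → Lp ℝ 2 (FracSPDE.cylinderMeasure D T),
          MemLp Y 2 P ∧
          (∀ᵐ ω ∂P, Y ω =ᵐ[FracSPDE.cylinderMeasure D T] y ω) ∧
          eLpNorm Y 2 P ≤ ENNReal.ofReal C) ∧
        AEMeasurable (fun ω ↦ eLpNorm (y ω) 2 (FracSPDE.cylinderMeasure D T)) P ∧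
        ∀ᵐ ω ∂P, MemLp (y ω) 2 (FracSPDE.cylinderMeasure D T) ∧
          eLpNorm (y ω) 2 (FracSPDE.cylinderMeasure D T) < ∞ := by
  -- The square root of the summed bound. The radicand is nonnegative whenever the hypotheses can
  -- hold, since `0 ≤ ∑' j, mu j ≤ M`.
  refine ⟨√(R ^ 2 / α ^ s + M * T ^ 2), Real.sqrt_nonneg _, ?_⟩
  intro D _ _ A _ e lam _ hlam Q mu hQ hM Ω mΩ P _ 𝓕 _ W B _ hB y₀ hy₀ y hy
  -- `mu j = ⟨Q (e j), e j⟩`.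
  have hmu : ∀ j, 0 ≤ mu j := fun j ↦ by
    have := hQ.positive.inner_nonneg_left (e j)
    simpa [hQ.apply_eq, inner_smul_left, e.orthonormal.1 j, real_inner_self_eq_norm_sq] using this
  have hbound := hy.lintegral_enorm_sq_le hT hs hα hlam hmu hQ.summable hM hB.brownian hy₀
  have : SigmaFinite (FracSPDE.cylinderMeasure D T) := by
    unfold FracSPDE.cylinderMeasure; infer_instance
  obtain ⟨Y, hYm, hYy, hY⟩ := FracSPDE.exists_memLp_Lp_of_lintegral_lt_top hy.measurable
    (hbound.trans_lt ENNReal.ofReal_lt_top)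
  have hle : eLpNorm Y 2 P ≤ ENNReal.ofReal √(R ^ 2 / α ^ s + M * T ^ 2) := by
    have hpos : 0 ≤ R ^ 2 / α ^ s + M * T ^ 2 := by
      have : 0 ≤ M := (tsum_nonneg hmu).trans hM
      positivity
    rw [← ENNReal.pow_le_pow_left_iff two_ne_zero, hY, ← ENNReal.ofReal_pow (Real.sqrt_nonneg _),
      Real.sq_sqrt hpos]
    exact hbound
  refine ⟨⟨Y, ⟨hYm, hle.trans_lt ENNReal.ofReal_lt_top⟩, hYy, hle⟩, ?_, ?_⟩
  · refine hYm.enorm.congr ?_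
    filter_upwards [hYy] with ω hω
    rw [Lp.enorm_def, eLpNorm_congr_ae hω]
  · filter_upwards [hYy] with ω hω
    have h := (memLp_congr_ae hω).mp (Lp.memLp (Y ω))
    exact ⟨h, h.2⟩
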